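/- Let $\Gamma$ be a countable discrete group equipped with a proper, right-invariant metric (such a metric exists and is unique up to coarse equivalence; proper means that closed balls are finite), and let $\operatorname{asdim}\Gamma\in\{0,1,2,\dots\}\cup\{\infty\}$ be the asymptotic dimension of $\Gamma$ for this metric: the least $n$ such that for every $r>0$ there are $R>0$ and sets $U_0,\dots,U_n$ covering $\Gamma$ such that any two points of $U_i$ that can be joined by a finite chain of points of $U_i$ with consecutive distances at most $r$ are at distance at most $R$ ($\infty$ if there is no such $n$). For a group $\Gamma$ acting freely by homeomorphisms on a compact metric space $X$ and a closed subspace $A\subseteq X$, let $\Gamma\curvearrowright A$ denote the restricted partial action, in which $\gamma\in\Gamma$ is defined on $D_\gamma=A\cap\gamma^{-1}A$ and maps $x\in D_\gamma$ to $\gamma\cdot x\in A$. Its dynamic asymptotic dimension $\mathrm{DAD}(\Gamma\curvearrowright A)$ is $-1$ if $A=\emptyset$, and otherwise the least integer $n\ge 0$ (or $\infty$ if there is none) such that for every finite $F\subseteq\Gamma$ there are relatively open sets $U_0,\dots,U_n$ covering $A$ and a number $N$ such that, for all $0\le j\le n$ and $x\in U_j$, the set of all $y=f_k\cdots f_1\cdot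 x$ with $k\ge1$, $f_1,\dots,f_k\in F$ and $f_i\cdots f_1\cdot x\in U_j$ for all $1\le i\le k$ has at most $N$ elements. The large inductive dimension is defined by $\operatorname{Ind}(\emptyset)=-1$ and, for a non-empty space $Z$, by letting $\operatorname{Ind}(Z)$ be the least integer $n\ge0$ (or $\infty$) such that for every closed $C\subseteq Z$ and open $U\supseteq C$ there is an open $V$ with $C\subseteq V\subseteq U$ and $\operatorname{Ind}(\partial V)\le n-1$. **Theorem.** Let $\Gamma$ be a countable discrete group with a proper right-invariant metric as above, acting freely by homeomorphisms on a compact metric space $X$, with $\mathrm{DAD}(\Gamma\curvearrowright X)\le d$ for some finite $d$. Then for every closed subspace $Y\subseteq X$ with $\operatorname{Ind}(Y)\le m$ for some finite $m$, $$\mathrm{DAD}(\Gamma\curvearrowright Y)\le\operatorname{asdim}\Gamma .$$ -/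

import Mathlib

universe u v

/-! ### Asymptotic dimension of a metric space -/

section Asdim

/-- The `r`-component of `x` in `A`: the points of `A` joined to `x` by an `r`-chain in `A`. -/
def rComponent {G : Type u} [MetricSpace G] (A : Set G) (r : ℝ) (x : G) : Set G :=
  {y | Relation.ReflTransGen (fun a b => a ∈ A ∧ b ∈ A ∧ dist a b ≤ r) x y}

/-- `U 0, …, U n` is a cover of `G` such that the `r`-components of each `U i` have
diameter at most `R`. -/
def IsAsdimCover {G : Type u} [MetricSpace G] (n : ℕ) (r R : ℝ)
    (U : Fin (n + 1) → Set G) : Prop :=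
  (⋃ i, U i) = Set.univ ∧
    ∀ i, ∀ x ∈ U i, ∀ y ∈ rComponent (U i) r x, ∀ z ∈ rComponent (U i) r x, dist y z ≤ R

/-- `asdim G ≤ n`, for a natural number `n`. -/
def AsdimLE (G : Type u) [MetricSpace G] (n : ℕ) : Prop :=
  ∀ r : ℝ, 0 < r → ∃ R : ℝ, 0 < R ∧ ∃ U : Fin (n + 1) → Set G, IsAsdimCover n r R U

open Classical in
/-- The asymptotic dimension: the least `n` with `asdim G ≤ n`, or `⊤` if there is none
(and `⊥`, standing for `-1`, if `G` is empty). -/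
noncomputable def asdim (G : Type u) [MetricSpace G] : WithBot ℕ∞ :=
  if IsEmpty G then ⊥ else ⨅ (n : ℕ) (_ : AsdimLE G n), (n : WithBot ℕ∞)

end Asdim

/-! ### Large inductive dimension -/

section LargeInductive

/-- `LargeIndLT n X` says that the large inductive dimension of `X` is less than `n`,
i.e. at most `n - 1`. -/
def LargeIndLT : ℕ → ∀ (X : Type u) [TopologicalSpace X], Prop
  | 0, X, _ => IsEmpty X
  | n + 1, X, _ => ∀ C U : Set X, IsClosed C → IsOpen U → C ⊆ U →
      ∃ V : Set X, IsOpen V ∧ C ⊆ V ∧ V ⊆ U ∧ LargeIndLT n (frontier V)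

open Classical in
/-- The large inductive dimension; the value `⊥` stands for `-1`, that of the empty space. -/
noncomputable def largeInd (X : Type u) [TopologicalSpace X] : WithBot ℕ∞ :=
  if IsEmpty X then ⊥ else ⨅ (n : ℕ) (_ : LargeIndLT (n + 1) X), (n : WithBot ℕ∞)

end LargeInductive

/-! ### Topological partial actions and dynamic asymptotic dimension -/

/-- A topological partial action of `Γ` on `X`. The domains are not required to be open. -/
structure TopPartialAction (Γ : Type u) (X : Type v) [Group Γ] [TopologicalSpace X] where
  dom : Γ → Set X
  map : ∀ γ : Γ, dom γ ≃ₜ dom γ⁻¹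
  dom_one : dom 1 = Set.univ
  map_one : ∀ x : dom 1, (map 1 x : X) = x
  map_mul : ∀ (γ δ : Γ) (x : dom δ) (h : (map δ x : X) ∈ dom γ),
    ∃ h' : (x : X) ∈ dom (γ * δ), (map (γ * δ) ⟨x, h'⟩ : X) = map γ ⟨map δ x, h⟩

namespace TopPartialAction

/-- The partial action is free: `θ_γ(x) = θ_δ(x)` only if `γ = δ`. -/
def IsFree {Γ : Type u} {X : Type v} [Group Γ] [TopologicalSpace X]
    (P : TopPartialAction Γ X) : Prop :=
  ∀ (γ δ : Γ) (x : X) (hγ : x ∈ P.dom γ) (hδ : x ∈ P.dom δ),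
    (P.map γ ⟨x, hγ⟩ : X) = P.map δ ⟨x, hδ⟩ → γ = δ

/-- One step inside `U`: `b = θ_f(a)` for some `f ∈ F` whose domain contains `a`, and `b ∈ U`. -/
def Step {Γ : Type u} {X : Type v} [Group Γ] [TopologicalSpace X]
    (P : TopPartialAction Γ X) (F : Finset Γ) (U : Set X) (a b : X) : Prop :=
  ∃ f ∈ F, ∃ h : a ∈ P.dom f, (P.map f ⟨a, h⟩ : X) = b ∧ b ∈ U

/-- The set of all `y = θ_{f_k} ∘ ⋯ ∘ θ_{f_1} (x)` with `k ≥ 1` and `f_1, …, f_k ∈ F`, such that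
`θ_{f_j} ∘ ⋯ ∘ θ_{f_1} (x)` exists and lies in `U` for all `1 ≤ j ≤ k`. -/
def reach {Γ : Type u} {X : Type v} [Group Γ] [TopologicalSpace X]
    (P : TopPartialAction Γ X) (F : Finset Γ) (U : Set X) (x : X) : Set X :=
  {y | Relation.TransGen (P.Step F U) x y}

/-- `DAD ≤ n`, for a natural number `n`. -/
def DadLE {Γ : Type u} {X : Type v} [Group Γ] [TopologicalSpace X]
    (P : TopPartialAction Γ X) (n : ℕ) : Prop :=
  ∀ F : Finset Γ, ∃ U : Fin (n + 1) → Set X,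
    (∀ j, IsOpen (U j)) ∧ (⋃ j, U j) = Set.univ ∧
      ∃ N : ℕ, ∀ j, ∀ x ∈ U j, (P.reach F (U j) x).encard ≤ N

open Classical in
/-- The dynamic asymptotic dimension of a (free) partial action on a (compact) space; the value
`⊥` stands for `-1`, that of the empty space. -/
noncomputable def dad {Γ : Type u} {X : Type v} [Group Γ] [TopologicalSpace X]
    (P : TopPartialAction Γ X) : WithBot ℕ∞ :=
  if IsEmpty X then ⊥ else ⨅ (n : ℕ) (_ : P.DadLE n), (n : WithBot ℕ∞)

/-- An action by homeomorphisms, as a partial action with all domains equal to `X`. -/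
def ofAction (Γ : Type u) (X : Type v) [Group Γ] [TopologicalSpace X] [MulAction Γ X]
    [ContinuousConstSMul Γ X] : TopPartialAction Γ X where
  dom _ := Set.univ
  map γ :=
    { toFun := fun x => ⟨γ • (x : X), trivial⟩
      invFun := fun x => ⟨γ⁻¹ • (x : X), trivial⟩
      left_inv := fun x => Subtype.ext (inv_smul_smul γ (x : X))
      right_inv := fun x => Subtype.ext (smul_inv_smul γ (x : X))
      continuous_toFun := by fun_prop
      continuous_invFun := by fun_prop }
  dom_one := rfl
  map_one x := one_smul Γ (x : X)
  map_mul γ δ x _ := ⟨trivial, mul_smul γ δ (x : X)⟩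

/-- The restriction of an action by homeomorphisms to a subspace `A`: the domain of `γ` is
`A ∩ γ⁻¹ A`, and `γ` acts there as it does on `X`. -/
def restrict (Γ : Type u) {X : Type v} [Group Γ] [TopologicalSpace X] [MulAction Γ X]
    [ContinuousConstSMul Γ X] (A : Set X) : TopPartialAction Γ A where
  dom γ := {a : A | γ • (a : X) ∈ A}
  map γ :=
    { toFun := fun x => ⟨⟨γ • ((x : A) : X), x.2⟩, by
        change γ⁻¹ • γ • ((x : A) : X) ∈ A
        rw [inv_smul_smul]; exact x.1.2⟩
      invFun := fun x => ⟨⟨γ⁻¹ • ((x : A) : X), x.2⟩, by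
        change γ • γ⁻¹ • ((x : A) : X) ∈ A
        rw [smul_inv_smul]; exact x.1.2⟩
      left_inv := fun x => Subtype.ext (Subtype.ext (inv_smul_smul γ ((x : A) : X)))
      right_inv := fun x => Subtype.ext (Subtype.ext (smul_inv_smul γ ((x : A) : X)))
      continuous_toFun := by fun_prop
      continuous_invFun := by fun_prop }
  dom_one := by
    ext a
    simp
  map_one x := Subtype.ext (one_smul Γ ((x : A) : X))
  map_mul γ δ x h := ⟨by
    change (γ * δ) • ((x : A) : X) ∈ A
    rw [mul_smul]; exact h, Subtype.ext (mul_smul γ δ ((x : A) : X))⟩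

end TopPartialAction

/-! Let `asdim Γ ≤ n`, with control function `ρ`. It suffices to cover `Y`, at each scale `r`, by `n
+ 1` closed sets whose `r`-components inside orbits are bounded: such closed sets thicken to open
ones with the same bound (`OrbitBdd.exists_isOpen`), and balls of `Γ` are finite.

Finite dynamic asymptotic dimension gives `d + 1` closed sets `K` with bounded `s`-components, for
any `s`. The component relation on `K ∩ Y` has finite classes and a closed quotient map. Freeness
makes this map injective on small closed pieces, so the image of `K ∩ Y` has covering dimension at
most that of `Y`. It is therefore covered by `m + 1` families of disjoint closed sets, each set
lying under a tower on which a point has a well-defined coordinate in `Γ`. Pulling covers of `Γ`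
back along the coordinates covers each family at every scale `t ≤ s` with bound `ρ t`, whatever the
bound on the `s`-components of `K` (`closedCover_iUnion_towers`, `exists_pieces_closedCover`).

The resulting `(d + 1) * (m + 1)` pieces are glued by the union theorem of asymptotic dimension.
Their number and `ρ` do not depend on `s`, so `s` can be fixed beforehand, large enough for all the
gluings (`exists_scale_closedCover_iUnion`). Thus `d` and `m` affect only the bounds, never the
number `n + 1` of sets. -/

open Set Topology

/-! ### Coarse components and the union theorem. -/

section CompBdd

/-- The `r`-components of `A` have radius at most `R` around each of their points. -/
def CompBdd {G : Type u} [MetricSpace G] (A : Set G) (r R : ℝ) : Prop :=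
  ∀ a ∈ A, ∀ b ∈ rComponent A r a, dist a b ≤ R

variable {G : Type u} [MetricSpace G]

theorem rComponent_refl (A : Set G) (r : ℝ) (a : G) : a ∈ rComponent A r a :=
  Relation.ReflTransGen.refl

theorem rComponent_subset {A : Set G} {r : ℝ} {a b : G} (ha : a ∈ A)
    (hb : b ∈ rComponent A r a) : b ∈ A := by
  rcases Relation.ReflTransGen.cases_tail hb with h | ⟨c, -, hc⟩
  · exact h ▸ ha
  · exact hc.2.1

theorem rComponent_tail {A : Set G} {r : ℝ} {a b c : G} (ha : a ∈ A)
    (hb : b ∈ rComponent A r a) (hc : c ∈ A) (hbc : dist b c ≤ r) : c ∈ rComponent A r a :=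
  Relation.ReflTransGen.tail hb ⟨rComponent_subset ha hb, hc, hbc⟩

theorem rComponent_mono {A B : Set G} {r s : ℝ} (hAB : A ⊆ B) (hrs : r ≤ s) (a : G) :
    rComponent A r a ⊆ rComponent B s a := fun _ hb =>
  Relation.ReflTransGen.mono (fun _ _ h => ⟨hAB h.1, hAB h.2.1, h.2.2.trans hrs⟩) _ _ hb

theorem rComponent_symm {A : Set G} {r : ℝ} {a b : G} (hb : b ∈ rComponent A r a) :
    a ∈ rComponent A r b :=
  have : Std.Symm fun a b => a ∈ A ∧ b ∈ A ∧ dist a b ≤ r :=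
    ⟨fun _ _ h => ⟨h.2.1, h.1, by rw [dist_comm]; exact h.2.2⟩⟩
  Relation.ReflTransGen.stdSymm.symm _ _ hb

/-- Between two visits to `W`, an `r`-chain makes an excursion in `V` of length at most `R`, with a
jump of at most `r` at either end. The visits to `W` thus form an `(R + 2 * r)`-chain; the first and
last excursions account for `2 * (R + r)`. -/
theorem CompBdd.union {V W : Set G} {r R D : ℝ} (hr : 0 ≤ r) (hR : 0 ≤ R) (hD : 0 ≤ D)
    (hV : CompBdd V r R) (hW : CompBdd W (R + 2 * r) D) :
    CompBdd (V ∪ W) r (D + 2 * (R + r)) := by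
  intro a ha b hb
  have inv : (a ∈ V ∧ b ∈ rComponent V r a) ∨ ∃ w ∈ W, ∃ w' ∈ rComponent W (R + 2 * r) w,
      dist a w ≤ R + r ∧ (b = w' ∨ ∃ v ∈ V, dist w' v ≤ r ∧ b ∈ rComponent V r v) := by
    induction hb with
    | refl =>
      rcases ha with ha | ha
      · exact .inl ⟨ha, rComponent_refl _ _ _⟩
      · exact .inr ⟨a, ha, a, rComponent_refl _ _ _, by rw [dist_self]; positivity, .inl rfl⟩
    | @tail b c _ hbc ih =>
      obtain ⟨-, hc, hd⟩ := hbc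
      rcases ih with ⟨hav, hb⟩ | ⟨w, hw, w', hw', haw, rfl | ⟨v, hv, hwv, hb⟩⟩
      · rcases hc with hc | hc
        · exact .inl ⟨hav, rComponent_tail hav hb hc hd⟩
        · have := hV a hav b hb
          exact .inr ⟨c, hc, c, rComponent_refl _ _ _,
            (dist_triangle a b c).trans (add_le_add this hd), .inl rfl⟩
      · rcases hc with hc | hc
        · exact .inr ⟨w, hw, b, hw', haw, .inr ⟨c, hc, hd, rComponent_refl _ _ _⟩⟩
        · exact .inr ⟨w, hw, c, rComponent_tail hw hw' hc (by linarith), haw, .inl rfl⟩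
      · rcases hc with hc | hc
        · exact .inr ⟨w, hw, w', hw', haw, .inr ⟨v, hv, hwv, rComponent_tail hv hb hc hd⟩⟩
        · have h1 := hV v hv b hb
          have h2 := dist_triangle4 w' v b c
          exact .inr ⟨w, hw, c, rComponent_tail hw hw' hc (by linarith), haw, .inl rfl⟩
  rcases inv with ⟨hav, hb⟩ | ⟨w, hw, w', hw', haw, rfl | ⟨v, hv, hwv, hb⟩⟩
  · have := hV a hav b hb
    linarith
  · have h1 := hW w hw b hw'
    have h2 := dist_triangle a w b
    linarith
  · have h1 := hW w hw w' hw'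
    have h2 := dist_triangle4 a w w' b
    have h3 := hV v hv b hb
    have h4 := dist_triangle w' v b
    linarith

theorem IsAsdimCover.compBdd {n : ℕ} {r R : ℝ} {U : Fin (n + 1) → Set G}
    (h : IsAsdimCover n r R U) (i : Fin (n + 1)) : CompBdd (U i) r R := fun a ha b hb =>
  h.2 i a ha a (rComponent_refl _ _ _) b hb

end CompBdd

/-! ### Covering dimension: sum theorem and comparison with `Ind`. -/

section Dimension

/-- A form of "the covering dimension of `A` is less than `m`": every finite open cover of `A` is
refined by `m` families of pairwise disjoint closed sets which together cover `A`. -/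
def CovDimLT {Z : Type v} [TopologicalSpace Z] (m : ℕ) (A : Set Z) : Prop :=
  ∀ (ι : Type v) [Finite ι] (O : ι → Set Z), (∀ i, IsOpen (O i)) → A ⊆ ⋃ i, O i →
    ∃ P : Fin m → ι → Set Z, (∀ c i, IsClosed (P c i)) ∧ (∀ c i, P c i ⊆ O i) ∧
      (∀ c i j, i ≠ j → Disjoint (P c i) (P c j)) ∧ A ⊆ ⋃ c, ⋃ i, P c i

variable {Z : Type v} [TopologicalSpace Z] {m : ℕ}

theorem CovDimLT.mono {A B : Set Z} (hB : CovDimLT m B) (hA : IsClosed A) (h : A ⊆ B) :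
    CovDimLT m A := by
  intro ι _ O hO hAO
  -- Adding the complement of `A` makes a cover of `B`; the pieces inside it miss `A` and are
  -- dropped.
  obtain ⟨P, h1, h2, h3, h4⟩ := hB (Option ι) (fun o => o.elim Aᶜ O)
    (by rintro (_ | i); exacts [hA.isOpen_compl, hO i]) (by
      intro x _
      by_cases hx : x ∈ A
      · obtain ⟨i, hi⟩ := mem_iUnion.1 (hAO hx)
        exact mem_iUnion.2 ⟨some i, hi⟩
      · exact mem_iUnion.2 ⟨none, hx⟩)
  refine ⟨fun c i => P c (some i), fun c i => h1 c _, fun c i => h2 c (some i),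
    fun c i j hij => h3 c _ _ (by simpa using hij), fun x hx => ?_⟩
  obtain ⟨c, o, hc⟩ := by simpa only [mem_iUnion] using h4 (h hx)
  rcases o with _ | i
  · exact absurd hx (h2 c none hc)
  · exact mem_iUnion₂.2 ⟨c, i, hc⟩

theorem CovDimLT.empty : CovDimLT m (∅ : Set Z) := fun _ _ _ _ _ =>
  ⟨fun _ _ => ∅, fun _ _ => isClosed_empty, fun _ _ => empty_subset _,
    fun _ _ _ _ => disjoint_empty _, empty_subset _⟩

/-- Choose families `P` for `A`, then cover `B` so finely that each set meets at most one member of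
every `P c`. A new piece of colour `c` is absorbed into the member it may meet, which keeps each
colour disjoint. -/
theorem CovDimLT.union {A B : Set Z} (hA : CovDimLT m A) (hB : CovDimLT m B) :
    CovDimLT m (A ∪ B) := by
  classical
  intro ι _ O hO hABO
  obtain ⟨P, hPc, hPO, hPd, hPA⟩ := hA ι O hO (subset_union_left.trans hABO)
  -- The label `none` means away from all of `P c`; `some i` means away from all members except `P c
  -- i`.
  let T : Fin m → Option ι → Set Z := fun c o =>
    o.elim (⋃ i, P c i)ᶜ fun i => O i \ ⋃ j ∈ {j | j ≠ i}, P c j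
  let O' : ((Fin m → Option ι) × ι) → Set Z := fun q => O q.2 ∩ ⋂ c, T c (q.1 c)
  have hT : ∀ c o, IsOpen (T c o) := by
    rintro c (_ | i)
    · exact (isClosed_iUnion_of_finite fun i => hPc c i).isOpen_compl
    · exact (hO i).sdiff ((toFinite _).isClosed_biUnion fun j _ => hPc c j)
  have hO' : ∀ q, IsOpen (O' q) := fun q =>
    (hO q.2).inter (isOpen_iInter_of_finite fun c => hT c _)
  obtain ⟨Q, hQc, hQO, hQd, hQB⟩ := hB _ O' hO' (by
    intro z hz
    obtain ⟨i, hi⟩ := mem_iUnion.1 (hABO (.inr hz))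
    have : ∀ c, ∃ o, z ∈ T c o := by
      intro c
      by_cases hz : ∃ j, z ∈ P c j
      · obtain ⟨j, hj⟩ := hz
        refine ⟨some j, hPO c j hj, ?_⟩
        simp only [mem_iUnion, not_exists]
        exact fun k hk hzk => (hPd c k j hk).le_bot ⟨hzk, hj⟩
      · exact ⟨none, by simpa [T] using hz⟩
    choose f hf using this
    exact mem_iUnion.2 ⟨(f, i), hi, mem_iInter.2 hf⟩)
  let φ : Fin m → ((Fin m → Option ι) × ι) → ι := fun c q => (q.1 c).getD q.2
  have hφO : ∀ c q, Q c q ⊆ O (φ c q) := by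
    intro c q x hx
    obtain ⟨h1, h2⟩ := hQO c q hx
    have h3 := mem_iInter.1 h2 c
    rcases h : q.1 c with _ | i
    · simpa [φ, h] using h1
    · rw [h] at h3
      simpa [φ, h] using h3.1
  have hφP : ∀ c q i, i ≠ φ c q → Disjoint (P c i) (Q c q) := by
    intro c q i hi
    rw [disjoint_left]
    intro x hxP hxQ
    have h3 := mem_iInter.1 (hQO c q hxQ).2 c
    rcases h : q.1 c with _ | j
    · rw [h] at h3
      exact h3 (mem_iUnion.2 ⟨i, hxP⟩)
    · rw [h] at h3
      simp only [φ, h, Option.getD_some] at hi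
      exact h3.2 (mem_iUnion₂.2 ⟨i, hi, hxP⟩)
  refine ⟨fun c i => P c i ∪ ⋃ q ∈ {q | φ c q = i}, Q c q, fun c i => ?_, fun c i => ?_,
    fun c i j hij => ?_, ?_⟩
  · exact (hPc c i).union ((toFinite _).isClosed_biUnion fun q _ => hQc c q)
  · refine union_subset (hPO c i) (iUnion₂_subset fun q hq => ?_)
    exact (hφO c q).trans (by rw [show φ c q = i from hq])
  · rw [disjoint_left]
    rintro x (hx | hx) (hy | hy)
    · exact (hPd c i j hij).le_bot ⟨hx, hy⟩
    · obtain ⟨q, rfl, hq⟩ := mem_iUnion₂.1 hy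
      exact (hφP c q i hij).le_bot ⟨hx, hq⟩
    · obtain ⟨q, rfl, hq⟩ := mem_iUnion₂.1 hx
      exact (hφP c q j hij.symm).le_bot ⟨hy, hq⟩
    · obtain ⟨q, rfl, hq⟩ := mem_iUnion₂.1 hx
      obtain ⟨q', rfl, hq'⟩ := mem_iUnion₂.1 hy
      exact (hQd c q q' fun h => hij (h ▸ rfl)).le_bot ⟨hq, hq'⟩
  · rintro x (hx | hx)
    · obtain ⟨c, i, h⟩ := mem_iUnion₂.1 (hPA hx)
      exact mem_iUnion₂.2 ⟨c, i, .inl h⟩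
    · obtain ⟨c, q, h⟩ := mem_iUnion₂.1 (hQB hx)
      exact mem_iUnion₂.2 ⟨c, φ c q, .inr (mem_iUnion₂.2 ⟨q, rfl, h⟩)⟩

theorem CovDimLT.biUnion_finset {κ : Type*} (s : Finset κ) {A : κ → Set Z}
    (h : ∀ k ∈ s, CovDimLT m (A k)) : CovDimLT m (⋃ k ∈ s, A k) := by
  classical
  induction s using Finset.induction_on with
  | empty => simpa using CovDimLT.empty
  | insert a s ha ih =>
    rw [Finset.set_biUnion_insert]
    exact (h a (Finset.mem_insert_self _ _)).union
      (ih fun k hk => h k (Finset.mem_insert_of_mem hk))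

theorem CovDimLT.image {Q : Type v} [TopologicalSpace Q] {A : Set Z} (hA : CovDimLT m A)
    (hAc : IsClosed A) {f : Z → Q} (hf : Continuous f) (hf' : IsClosedMap f) (hinj : InjOn f A) :
    CovDimLT m (f '' A) := by
  intro ι _ O hO hAO
  obtain ⟨P, h1, h2, h3, h4⟩ := hA ι (fun i => f ⁻¹' O i) (fun i => (hO i).preimage hf) (by
    rw [← preimage_iUnion]; exact image_subset_iff.1 hAO)
  refine ⟨fun c i => f '' (P c i ∩ A), fun c i => hf' _ ((h1 c i).inter hAc), fun c i => ?_,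
    fun c i j hij => ?_, ?_⟩
  · exact image_subset_iff.2 (inter_subset_left.trans (h2 c i))
  · rw [disjoint_left]
    rintro _ ⟨x, hx, rfl⟩ ⟨y, hy, hxy⟩
    exact (h3 c i j hij).le_bot ⟨hx.1, hinj hy.2 hx.2 hxy ▸ hy.1⟩
  · rintro _ ⟨x, hx, rfl⟩
    obtain ⟨c, i, h⟩ := mem_iUnion₂.1 (h4 hx)
    exact mem_iUnion₂.2 ⟨c, i, x, ⟨h, hx⟩, rfl⟩

/-- In a normal space a finite family of disjoint closed sets has neighbourhoods with disjoint
closures. -/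
theorem exists_open_disjoint_closure [NormalSpace Z] {ι : Type*} [Finite ι] {P O : ι → Set Z}
    (hP : ∀ i, IsClosed (P i)) (hO : ∀ i, IsOpen (O i)) (hPO : ∀ i, P i ⊆ O i)
    (hd : ∀ i j, i ≠ j → Disjoint (P i) (P j)) :
    ∃ H : ι → Set Z, (∀ i, IsOpen (H i)) ∧ (∀ i, P i ⊆ H i) ∧ (∀ i, closure (H i) ⊆ O i) ∧
      ∀ i j, i ≠ j → Disjoint (closure (H i)) (closure (H j)) := by
  have h1 : ∀ i, ∃ G, IsOpen G ∧ P i ⊆ G ∧ closure G ⊆ O i \ ⋃ j ∈ {j | j ≠ i}, P j := fun i =>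
    normal_exists_closure_subset (hP i)
      ((hO i).sdiff ((toFinite _).isClosed_biUnion fun j _ => hP j)) fun x hx => ⟨hPO i hx, by
        simp only [mem_iUnion, not_exists]
        exact fun j hj hxj => (hd j i hj).le_bot ⟨hxj, hx⟩⟩
  choose G hGo hPG hG using h1
  have h2 : ∀ i, ∃ H, IsOpen H ∧ P i ⊆ H ∧ closure H ⊆ G i \ ⋃ j ∈ {j | j ≠ i}, closure (G j) :=
    fun i => normal_exists_closure_subset (hP i)
      ((hGo i).sdiff ((toFinite _).isClosed_biUnion fun j _ => isClosed_closure))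
      fun x hx => ⟨hPG i hx, by
        simp only [mem_iUnion, not_exists]
        exact fun j hj hxj => (hG j hxj).2 (mem_iUnion₂.2 ⟨i, Ne.symm hj, hx⟩)⟩
  choose H hHo hPH hH using h2
  refine ⟨H, hHo, hPH, fun i x hx => (hG i (subset_closure (hH i hx).1)).1, fun i j hij => ?_⟩
  rw [disjoint_left]
  exact fun x hi hj => (hH j hj).2 (mem_iUnion₂.2 ⟨i, hij, subset_closure (hH i hi).1⟩)

/-- Shrink the cover to sets `V i` with frontiers of smaller dimension. By induction and the sum
theorem `m` families handle the frontiers; off a neighbourhood `W` of these the `V i` are clopen,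
and making them disjoint gives one more family. -/
theorem LargeIndLT.covDimLT : ∀ (m : ℕ) (Z : Type v) [TopologicalSpace Z] [NormalSpace Z],
    LargeIndLT m Z → CovDimLT m (univ : Set Z)
  | 0, Z, _, _, h => by
    have : IsEmpty Z := h
    rw [univ_eq_empty_iff.2 this]
    exact CovDimLT.empty
  | m + 1, Z, _, _, h => by
    intro ι _ O hO hcov
    obtain ⟨C, hC, hCc, hCO⟩ := exists_iUnion_eq_closed_subset hO (fun x => toFinite _)
      (univ_subset_iff.1 hcov)
    choose V hVo hCV hVO hV using fun i => h (C i) (O i) (hCc i) (hO i) (hCO i)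
    have hVcov : ∀ x, ∃ i, x ∈ V i := fun x => by
      obtain ⟨i, hi⟩ := mem_iUnion.1 (hC ▸ mem_univ x : x ∈ ⋃ i, C i)
      exact ⟨i, hCV i hi⟩
    have hB : CovDimLT m (⋃ i, frontier (V i)) := by
      have := Fintype.ofFinite ι
      have h1 : ∀ i ∈ Finset.univ, CovDimLT m (frontier (V i)) := by
        intro i _
        have hcl : IsClosed (frontier (V i)) := isClosed_frontier
        have : NormalSpace (frontier (V i)) := hcl.isClosedEmbedding_subtypeVal.normalSpace
        have h2 := (LargeIndLT.covDimLT m _ (hV i)).image isClosed_univ continuous_subtype_val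
          hcl.isClosedEmbedding_subtypeVal.isClosedMap Subtype.val_injective.injOn
        simpa using h2
      simpa using CovDimLT.biUnion_finset Finset.univ h1
    obtain ⟨P, hPc, hPO, hPd, hPB⟩ := hB ι O hO ((subset_univ _).trans hcov)
    choose H hHo hPH hHO hHd using fun c => exists_open_disjoint_closure (hPc c) hO (hPO c) (hPd c)
    let W : Set Z := ⋃ c, ⋃ i, H c i
    have hWo : IsOpen W := isOpen_iUnion fun c => isOpen_iUnion fun i => hHo c i
    have hfr : ∀ i x, x ∈ closure (V i) → x ∉ W → x ∈ V i := by
      intro i x hx hxW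
      by_contra hxV
      have : x ∈ frontier (V i) := by rw [(hVo i).frontier_eq]; exact ⟨hx, hxV⟩
      obtain ⟨c, j, hj⟩ := mem_iUnion₂.1 (hPB (mem_iUnion.2 ⟨i, this⟩))
      exact hxW (mem_iUnion₂.2 ⟨c, j, hPH c j hj⟩)
    obtain ⟨q, ⟨e⟩⟩ := Finite.exists_equiv_fin ι
    -- Off `W`, `closure (V i)` and `V i` agree, so these differences are closed and disjoint.
    let K : ι → Set Z := fun i => (closure (V i) ∩ ⋂ j ∈ {j | e j < e i}, (V j)ᶜ) \ W
    have hKd : ∀ i j, e i < e j → Disjoint (K i) (K j) := by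
      intro i j hij
      rw [disjoint_left]
      intro x hi hj
      exact mem_iInter₂.1 hj.1.2 i hij (hfr i x hi.1.1 hi.2)
    refine ⟨Fin.snoc (fun c i => closure (H c i)) K, ?_, ?_, ?_, ?_⟩
    · refine Fin.lastCases ?_ ?_
      · intro i
        rw [Fin.snoc_last]
        exact (isClosed_closure.inter (isClosed_biInter fun j _ =>
          (hVo j).isClosed_compl)).sdiff hWo
      · intro c i
        rw [Fin.snoc_castSucc]
        exact isClosed_closure
    · refine Fin.lastCases ?_ ?_
      · intro i
        rw [Fin.snoc_last]
        exact fun x hx => hVO i (hfr i x hx.1.1 hx.2)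
      · intro c i
        rw [Fin.snoc_castSucc]
        exact hHO c i
    · refine Fin.lastCases ?_ ?_
      · intro i j hij
        rw [Fin.snoc_last]
        rcases lt_or_gt_of_ne (e.injective.ne hij) with h | h
        · exact hKd i j h
        · exact (hKd j i h).symm
      · intro c
        rw [Fin.snoc_castSucc]
        exact hHd c
    · intro x _
      by_cases hxW : x ∈ W
      · obtain ⟨c, i, hi⟩ := mem_iUnion₂.1 hxW
        exact mem_iUnion₂.2 ⟨c.castSucc, i, by rw [Fin.snoc_castSucc]; exact subset_closure hi⟩
      · obtain ⟨i, hi, hmin⟩ := exists_minimalFor_of_wellFoundedLT (fun i => x ∈ V i) e (hVcov x)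
        refine mem_iUnion₂.2 ⟨Fin.last m, i, ?_⟩
        rw [Fin.snoc_last]
        exact ⟨⟨subset_closure hi, mem_iInter₂.2 fun j hj hxj =>
          absurd (hmin hxj (le_of_lt hj)) (not_le_of_gt hj)⟩, hxW⟩

end Dimension

/-! ### Bounded components in orbits: thickening and gluing. -/

section Orbits

variable {Γ : Type u} [Group Γ] {X : Type v} [MulAction Γ X]

/-- The set of group elements which carry `x` into `S`. -/
def returnSet (Γ : Type u) [Group Γ] {X : Type v} [MulAction Γ X] (S : Set X) (x : X) : Set Γ :=
  {g | g • x ∈ S}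

theorem one_mem_returnSet {S : Set X} {x : X} (hx : x ∈ S) : (1 : Γ) ∈ returnSet Γ S x := by
  change (1 : Γ) • x ∈ S
  rwa [one_smul]

theorem exists_succ_subset_of_encard_le {α : Type*} {S : Set α} {N : ℕ} (hS : S.encard ≤ N)
    {T : ℕ → Set α} (hT : Monotone T) (hTS : ∀ k, T k ⊆ S) : ∃ k ≤ N, T (k + 1) ⊆ T k := by
  by_contra! h
  have hfin : S.Finite := finite_of_encard_le_coe hS
  have key : ∀ k ≤ N + 1, (k : ℕ∞) ≤ (T k).encard := by
    intro k
    induction k with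
    | zero => simp
    | succ k ih =>
      intro hk
      have h1 : T k ⊂ T (k + 1) := ⟨hT k.le_succ, h k (by omega)⟩
      have h2 := (hfin.subset (hTS k)).encard_lt_encard h1
      have h3 := ih (by omega)
      push_cast
      exact Order.add_one_le_of_lt (h3.trans_lt h2)
  have h1 := (key (N + 1) le_rfl).trans ((encard_le_encard (hTS _)).trans hS)
  have h2 : N + 1 ≤ N := by exact_mod_cast h1
  omega

/-- Finitely many non-trivial elements of a freely acting group move all points of a small
neighbourhood off that neighbourhood. -/
theorem exists_open_smul_notMem [TopologicalSpace X] [T3Space X] [ContinuousConstSMul Γ X]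
    (hfree : ∀ (g : Γ) (x : X), g • x = x → g = 1) {S : Set Γ} (hS : S.Finite) (x : X) :
    ∃ G : Set X, IsOpen G ∧ x ∈ G ∧ ∀ g ∈ S, ∀ z ∈ closure G, g • z ∈ closure G → g = 1 := by
  have h1 : ∀ g : Γ, ∃ W ∈ 𝓝 x, ∀ z ∈ W, g • z ∈ W → g = 1 := by
    intro g
    by_cases hg : g = 1
    · exact ⟨univ, Filter.univ_mem, fun _ _ _ => hg⟩
    · obtain ⟨A, B, hA, hB, hxA, hxB, hd⟩ := t2_separation fun h => hg (hfree g x h)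
      refine ⟨B ∩ (fun z => g • z) ⁻¹' A, Filter.inter_mem (hB.mem_nhds hxB)
        ((hA.preimage (continuous_const_smul g)).mem_nhds hxA), fun z hz hgz => ?_⟩
      exact absurd hgz.1 (disjoint_left.1 hd hz.2)
  choose W hW hWg using h1
  have h2 : ⋂ g ∈ S, W g ∈ 𝓝 x := (Filter.biInter_mem hS).2 fun g _ => hW g
  obtain ⟨C, hC, hCc, hCW⟩ := exists_mem_nhds_isClosed_subset h2
  refine ⟨interior C, isOpen_interior, mem_interior_iff_mem_nhds.2 hC, fun g hg z hz hgz => ?_⟩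
  have h3 : closure (interior C) ⊆ W g := (closure_minimal interior_subset hCc).trans
    (hCW.trans (biInter_subset_of_mem hg))
  exact hWg g z (h3 hz) (h3 hgz)

variable [MetricSpace Γ]

theorem dist_mul_self (hinv : ∀ a b c : Γ, dist (a * c) (b * c) = dist a b) (a b : Γ) :
    dist (a * b) b = dist a 1 := by
  simpa using hinv a 1 b

theorem dist_mul_one_le (hinv : ∀ a b c : Γ, dist (a * c) (b * c) = dist a b) (a b : Γ) :
    dist (a * b) 1 ≤ dist a 1 + dist b 1 := by
  rw [← dist_mul_self hinv a b]
  exact dist_triangle _ _ _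

theorem dist_inv_one (hinv : ∀ a b c : Γ, dist (a * c) (b * c) = dist a b) (a : Γ) :
    dist a⁻¹ 1 = dist a 1 := by
  rw [← hinv a⁻¹ 1 a, inv_mul_cancel, one_mul, dist_comm]

theorem finite_dist_one_le (hproper : ∀ (γ : Γ) (r : ℝ), (Metric.closedBall γ r).Finite) (r : ℝ) :
    {g : Γ | dist g 1 ≤ r}.Finite := hproper 1 r

theorem rComponent_returnSet_smul (hinv : ∀ a b c : Γ, dist (a * c) (b * c) = dist a b)
    {S : Set X} {x : X} {r : ℝ} {a b : Γ} (h : b ∈ rComponent (returnSet Γ S x) r a) (g : Γ) :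
    b * g⁻¹ ∈ rComponent (returnSet Γ S (g • x)) r (a * g⁻¹) :=
  Relation.ReflTransGen.lift (· * g⁻¹) (fun p q hpq => by
    refine ⟨?_, ?_, ?_⟩
    · change (p * g⁻¹) • g • x ∈ S
      rw [smul_smul, inv_mul_cancel_right]
      exact hpq.1
    · change (q * g⁻¹) • g • x ∈ S
      rw [smul_smul, inv_mul_cancel_right]
      exact hpq.2.1
    · rw [hinv]
      exact hpq.2.2) _ _ h

/-- The `r`-components of `S` inside the orbits of `Γ` are bounded by `R`, each orbit carrying the
metric of `Γ`. -/
def OrbitBdd (Γ : Type u) [Group Γ] [MetricSpace Γ] {X : Type v} [MulAction Γ X]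
    (S : Set X) (r R : ℝ) : Prop :=
  ∀ x ∈ S, ∀ g ∈ rComponent (returnSet Γ S x) r 1, dist g 1 ≤ R

theorem orbitBdd_iff (hinv : ∀ a b c : Γ, dist (a * c) (b * c) = dist a b) {S : Set X} {r R : ℝ} :
    OrbitBdd Γ S r R ↔ ∀ x, CompBdd (returnSet Γ S x) r R := by
  refine ⟨fun h x a ha b hb => ?_, fun h x hx g hg => ?_⟩
  · have h1 := rComponent_returnSet_smul hinv hb a
    rw [mul_inv_cancel] at h1
    have h2 := h (a • x) ha _ h1
    rwa [← hinv _ _ a, inv_mul_cancel_right, one_mul, dist_comm] at h2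
  · rw [dist_comm]
    exact h x 1 (one_mem_returnSet hx) g hg

theorem OrbitBdd.mono {S T : Set X} {r R : ℝ} (h : OrbitBdd Γ T r R) (hST : S ⊆ T) :
    OrbitBdd Γ S r R := fun x hx g hg =>
  h x (hST hx) g (rComponent_mono (B := returnSet Γ T x) (fun _ ha => hST ha) le_rfl _ hg)

theorem OrbitBdd.union (hinv : ∀ a b c : Γ, dist (a * c) (b * c) = dist a b) {V W : Set X}
    {r R D : ℝ} (hr : 0 ≤ r) (hR : 0 ≤ R) (hD : 0 ≤ D) (hV : OrbitBdd Γ V r R)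
    (hW : OrbitBdd Γ W (R + 2 * r) D) : OrbitBdd Γ (V ∪ W) r (D + 2 * (R + r)) := by
  rw [orbitBdd_iff hinv] at hV hW ⊢
  exact fun x => (hV x).union hr hR hD (hW x)

/-- A closed set with bounded `r`-components has a neighbourhood with the same property. -/
theorem OrbitBdd.exists_isOpen [TopologicalSpace X] [NormalSpace X] [ContinuousConstSMul Γ X]
    (hproper : ∀ (γ : Γ) (r : ℝ), (Metric.closedBall γ r).Finite)
    {K : Set X} (hK : IsClosed K)
    {r R : ℝ} (hr : 0 ≤ r) (hR : 0 ≤ R) (h : OrbitBdd Γ K r R) :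
    ∃ G : Set X, IsOpen G ∧ K ⊆ G ∧ OrbitBdd Γ G r R := by
  -- The first point of an `r`-chain to leave the `R`-ball is still within `r + R`, so only finitely
  -- many patterns `𝒩` witness failure of the bound.
  let B : Set Γ := {g | dist g 1 ≤ r + R}
  have hB : B.Finite := finite_dist_one_le hproper _
  let 𝒩 : Set (Set Γ) := {N | N ⊆ B ∧ 1 ∈ N ∧ ∃ g ∈ rComponent N r 1, ¬ dist g 1 ≤ R}
  have h𝒩 : 𝒩.Finite := hB.finite_subsets.subset fun N hN => hN.1
  have key : ∀ N ∈ 𝒩, ∃ G : Set X, IsOpen G ∧ K ⊆ G ∧ ∀ x, ∃ g ∈ N, g • x ∉ G := by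
    rintro N ⟨hNB, h1N, g, hg, hgR⟩
    have hNf : Finite N := hB.subset hNB
    -- No orbit realises the bad pattern `N` in `K`, so the open sets where `a • x ∉ K`, for `a ∈
    -- N`, cover `X`. Shrinking them to closed sets leaves room to enlarge `K`.
    obtain ⟨C, hC, hCc, hCK⟩ := exists_iUnion_eq_closed_subset (ι := N)
      (u := fun a => ((fun x : X => (a : Γ) • x) ⁻¹' K)ᶜ)
      (fun a => (hK.preimage (continuous_const_smul _)).isOpen_compl) (fun _ => toFinite _) (by
        refine eq_univ_of_forall fun x => ?_
        by_contra hx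
        simp only [mem_iUnion, mem_compl_iff, mem_preimage, not_exists, not_not] at hx
        refine hgR (h x ?_ g (rComponent_mono (fun a ha => hx ⟨a, ha⟩) le_rfl _ hg))
        simpa using hx ⟨1, h1N⟩)
    refine ⟨(⋃ a : N, (fun x : X => (a : Γ) • x) '' C a)ᶜ, ?_, ?_, fun x => ?_⟩
    · exact (isClosed_iUnion_of_finite fun a : N =>
        (Homeomorph.smul (a : Γ)).isClosedMap _ (hCc a)).isOpen_compl
    · intro x hx hx'
      obtain ⟨a, y, hy, rfl⟩ := mem_iUnion.1 hx'
      exact hCK a hy hx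
    · obtain ⟨a, ha⟩ := mem_iUnion.1 (hC ▸ mem_univ x : x ∈ ⋃ a, C a)
      exact ⟨a, a.2, fun hG => hG (mem_iUnion.2 ⟨a, x, ha, rfl⟩)⟩
  choose! G hGo hKG hG using key
  refine ⟨⋂ N ∈ 𝒩, G N, h𝒩.isOpen_biInter fun N hN => hGo N hN,
    subset_iInter₂ fun N hN => hKG N hN, fun x hx g hg => ?_⟩
  set G' := ⋂ N ∈ 𝒩, G N
  have h1 : (1 : Γ) ∈ returnSet Γ G' x ∩ B := by
    refine ⟨one_mem_returnSet hx, ?_⟩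
    change dist (1 : Γ) 1 ≤ r + R
    rw [dist_self]
    positivity
  suffices g ∈ rComponent (returnSet Γ G' x ∩ B) r 1 ∧ dist g 1 ≤ R from this.2
  induction hg with
  | refl => exact ⟨rComponent_refl _ _ _, by rwa [dist_self]⟩
  | @tail a b _ hab ih =>
    have hbB : b ∈ B := by
      change dist b 1 ≤ r + R
      have := dist_triangle b a 1
      rw [dist_comm b a] at this
      linarith [hab.2.2, ih.2]
    have hb := rComponent_tail h1 ih.1 ⟨hab.2.1, hbB⟩ hab.2.2
    refine ⟨hb, ?_⟩
    by_contra hbR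
    have hN : returnSet Γ G' x ∩ B ∈ 𝒩 := ⟨inter_subset_right, h1, b, hb, hbR⟩
    obtain ⟨a, ha, haG⟩ := hG _ hN x
    exact haG (mem_iInter₂.1 ha.1 _ hN)

/-- `A` is covered by `n + 1` closed sets with `r`-components bounded by `R`. -/
def ClosedCover (Γ : Type u) [Group Γ] [MetricSpace Γ] {X : Type v} [MulAction Γ X]
    [TopologicalSpace X] (n : ℕ) (A : Set X) (r R : ℝ) : Prop :=
  ∃ K : Fin (n + 1) → Set X, (∀ j, IsClosed (K j)) ∧ A ⊆ ⋃ j, K j ∧ ∀ j, OrbitBdd Γ (K j) r R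

variable [TopologicalSpace X]

theorem ClosedCover.union (hinv : ∀ a b c : Γ, dist (a * c) (b * c) = dist a b) {n : ℕ}
    {A B : Set X} {r R D : ℝ} (hr : 0 ≤ r) (hR : 0 ≤ R) (hD : 0 ≤ D)
    (hA : ClosedCover Γ n A r R) (hB : ClosedCover Γ n B (R + 2 * r) D) :
    ClosedCover Γ n (A ∪ B) r (D + 2 * (R + r)) := by
  obtain ⟨V, h1, h2, h3⟩ := hA
  obtain ⟨W, h4, h5, h6⟩ := hB
  refine ⟨fun j => V j ∪ W j, fun j => (h1 j).union (h4 j), ?_,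
    fun j => (h3 j).union hinv hr hR hD (h6 j)⟩
  rw [iUnion_union_distrib]
  exact union_subset_union h2 h5

/-- Each gluing demands a larger scale from the remaining sets, but these scales depend only on `ρ`,
`M` and `r`. Hence `s` and `R` are chosen before the sets. -/
theorem exists_scale_closedCover_iUnion (hinv : ∀ a b c : Γ, dist (a * c) (b * c) = dist a b)
    (n : ℕ) {ρ : ℝ → ℝ} (hρ : ∀ t, 0 < t → 0 < ρ t) (M : ℕ) : ∀ r, 0 < r → ∃ s, 0 < s ∧ ∃ R, 0 < R ∧
      ∀ A : Fin M → Set X, (∀ i t, 0 < t → t ≤ s → ClosedCover Γ n (A i) t (ρ t)) →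
        ClosedCover Γ n (⋃ i, A i) r R := by
  induction M with
  | zero =>
    refine fun r hr => ⟨1, one_pos, 1, one_pos, fun A _ => ⟨fun _ => ∅, fun _ => isClosed_empty, ?_,
      fun _ x hx => hx.elim⟩⟩
    simp
  | succ M ih =>
    intro r hr
    have h0 := hρ r hr
    obtain ⟨s, hs, R, hR, h⟩ := ih (ρ r + 2 * r) (by positivity)
    refine ⟨max r s, lt_max_of_lt_left hr, R + 2 * (ρ r + r), by positivity, fun A hA => ?_⟩
    have h1 : ⋃ i, A i = A 0 ∪ ⋃ i : Fin M, A i.succ := by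
      ext x
      simp [Fin.exists_fin_succ]
    rw [h1]
    exact (hA 0 r hr (le_max_left _ _)).union hinv hr.le h0.le hR.le
      (h _ fun i t ht hts => hA _ t ht (hts.trans (le_max_right _ _)))

end Orbits

/-! ### The quotient by components, and towers. -/

section Components

variable {Γ : Type u} [Group Γ] [MetricSpace Γ] {X : Type v} [MulAction Γ X]

theorem rComponent_subset_rComponent_inter {G : Type u} [MetricSpace G] (A : Set G) (r : ℝ)
    (a : G) : rComponent A r a ⊆ rComponent (A ∩ rComponent A r a) r a := by
  intro b hb
  induction hb with
  | refl => exact rComponent_refl _ _ _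
  | @tail b c hb hbc ih =>
    exact Relation.ReflTransGen.tail ih ⟨⟨hbc.1, hb⟩, ⟨hbc.2.1, hb.tail hbc⟩, hbc.2.2⟩

theorem eq_of_mem_rComponent_of_notMem {G : Type u} [MetricSpace G] {A : Set G} {r : ℝ} {a b : G}
    (ha : a ∉ A) (hb : b ∈ rComponent A r a) : b = a := by
  rcases Relation.ReflTransGen.cases_head hb with h | ⟨c, hc, -⟩
  · exact h.symm
  · exact absurd hc.1 ha

/-- Two points are related if they are equal or lie in the same `r`-component of `S` inside an
orbit. -/
def componentSetoid (hinv : ∀ a b c : Γ, dist (a * c) (b * c) = dist a b) (S : Set X) (r : ℝ) :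
    Setoid X where
  r x y := ∃ g ∈ rComponent (returnSet Γ S x) r 1, g • x = y
  iseqv :=
    { refl := fun x => ⟨1, rComponent_refl _ _ _, one_smul _ _⟩
      symm := by
        rintro x _ ⟨g, hg, rfl⟩
        refine ⟨g⁻¹, ?_, inv_smul_smul g x⟩
        simpa using rComponent_returnSet_smul hinv (rComponent_symm hg) g
      trans := by
        rintro x _ _ ⟨g, hg, rfl⟩ ⟨k, hk, rfl⟩
        have h : k * g ∈ rComponent (returnSet Γ S x) r g := by
          simpa using rComponent_returnSet_smul hinv hk g⁻¹
        exact ⟨k * g, Relation.ReflTransGen.trans hg h, mul_smul k g x⟩ }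

theorem exists_of_componentSetoid {hinv : ∀ a b c : Γ, dist (a * c) (b * c) = dist a b}
    {S : Set X} {r R : ℝ} (h : OrbitBdd Γ S r R) {x y : X} (hx : x ∈ S)
    (hxy : (componentSetoid hinv S r) x y) : y ∈ S ∧ ∃ g : Γ, dist g 1 ≤ R ∧ g • x = y := by
  obtain ⟨g, hg, rfl⟩ := hxy
  exact ⟨rComponent_subset (A := returnSet Γ S x) (one_mem_returnSet hx) hg, g, h x hx g hg, rfl⟩

variable [TopologicalSpace X]

/-- The saturation of a closed set is a finite union of translates of closed sets, one for each
pattern `N` in the `D`-ball and each `g` that `N` connects to `1`. Requiring only that `N` carry `x`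
into `K`, not that it be the exact return set, is a closed condition. -/
theorem isClosedMap_mk_componentSetoid [ContinuousConstSMul Γ X]
    (hproper : ∀ (γ : Γ) (r : ℝ), (Metric.closedBall γ r).Finite)
    {hinv : ∀ a b c : Γ, dist (a * c) (b * c) = dist a b} {K : Set X} (hK : IsClosed K)
    {r D : ℝ} (hD : 0 ≤ D) (h : OrbitBdd Γ K r D) :
    IsClosedMap (Quotient.mk (componentSetoid hinv K r)) := by
  intro C hC
  rw [← isQuotientMap_quotient_mk'.isClosed_preimage]
  let B : Set Γ := {g | dist g 1 ≤ D}
  have hB : B.Finite := finite_dist_one_le hproper _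
  have key : Quotient.mk (componentSetoid hinv K r) ⁻¹' (Quotient.mk _ '' C) =
      ⋃ N ∈ {N | N ⊆ B}, ⋃ g ∈ B ∩ rComponent N r 1,
        (fun x : X => g • x) '' (C ∩ ⋂ a ∈ N, (fun x : X => a • x) ⁻¹' K) := by
    ext y
    simp only [mem_preimage, mem_iUnion₂]
    constructor
    · rintro ⟨x, hx, hxy⟩
      obtain ⟨g, hg, rfl⟩ := Quotient.exact hxy
      have hbd : ∀ a ∈ rComponent (returnSet Γ K x) r 1, dist a 1 ≤ D := by
        intro a ha
        by_cases hxK : x ∈ K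
        · exact h x hxK a ha
        · rw [eq_of_mem_rComponent_of_notMem (fun h1 => hxK ?_) ha, dist_self]
          · exact hD
          · simpa [returnSet] using h1
      exact ⟨returnSet Γ K x ∩ rComponent (returnSet Γ K x) r 1, fun a ha => hbd a ha.2, g,
        ⟨hbd g hg, rComponent_subset_rComponent_inter _ _ _ hg⟩, x,
        ⟨hx, mem_iInter₂.2 fun a ha => ha.1⟩, rfl⟩
    · rintro ⟨N, -, g, ⟨-, hg⟩, x, ⟨hxC, hxN⟩, rfl⟩
      exact ⟨x, hxC, Quotient.sound ⟨g, rComponent_mono (fun a ha => mem_iInter₂.1 hxN a ha)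
        le_rfl _ hg, rfl⟩⟩
  change IsClosed (Quotient.mk (componentSetoid hinv K r) ⁻¹' (Quotient.mk _ '' C))
  rw [key]
  refine hB.finite_subsets.isClosed_biUnion fun N _ =>
    (hB.inter_of_left _).isClosed_biUnion fun g _ => ?_
  exact (Homeomorph.smul g).isClosedMap _ (hC.inter (isClosed_biInter fun a _ =>
    hK.preimage (continuous_const_smul a)))

/-- A disjoint union of finitely many `r`-saturated towers over closed bases inherits closed covers
from covers of the group. -/
theorem closedCover_iUnion_towers [ContinuousConstSMul Γ X]
    (hproper : ∀ (γ : Γ) (r : ℝ), (Metric.closedBall γ r).Finite)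
    (hinv : ∀ a b c : Γ, dist (a * c) (b * c) = dist a b) {K : Set X} {r D : ℝ}
    {ι : Type*} [Finite ι] {P N : ι → Set X} (hPc : ∀ i, IsClosed (P i)) (hPK : ∀ i, P i ⊆ K)
    (hPs : ∀ i, ∀ x ∈ P i, ∀ b : Γ, dist b 1 ≤ r → b • x ∈ K → b • x ∈ P i)
    (hPd : ∀ i j, i ≠ j → Disjoint (P i) (P j)) (hNc : ∀ i, IsClosed (N i))
    (hN : ∀ i, ∀ g : Γ, dist g 1 ≤ D + r + D → ∀ z ∈ N i, g • z ∈ N i → g = 1)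
    (hPN : ∀ i, ∀ x ∈ P i, ∃ g : Γ, dist g 1 ≤ D ∧ g⁻¹ • x ∈ N i)
    {n : ℕ} {t R : ℝ} (ht : t ≤ r) {U : Fin (n + 1) → Set Γ} (hU : IsAsdimCover n t R U) :
    ClosedCover Γ n (⋃ i, P i) t R := by
  refine ⟨fun j => ⋃ i, ⋃ γ ∈ {γ | dist γ 1 ≤ D ∧ γ ∈ U j},
    P i ∩ (fun x => γ⁻¹ • x) ⁻¹' N i, fun j => ?_, ?_, fun j => ?_⟩
  · refine isClosed_iUnion_of_finite fun i => ((finite_dist_one_le hproper D).subset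
      fun γ hγ => hγ.1).isClosed_biUnion fun γ _ => ?_
    exact (hPc i).inter ((hNc i).preimage (continuous_const_smul _))
  · refine iUnion_subset fun i x hx => ?_
    obtain ⟨g, hg, hgx⟩ := hPN i x hx
    obtain ⟨j, hj⟩ := mem_iUnion.1 (hU.1 ▸ mem_univ g : g ∈ ⋃ j, U j)
    exact mem_iUnion.2 ⟨j, mem_iUnion.2 ⟨i, mem_iUnion₂.2 ⟨g, ⟨hg, hj⟩, hx, hgx⟩⟩⟩
  · intro x hx g hg
    obtain ⟨i, γ, ⟨hγD, hγU⟩, hxP, hxN⟩ := by simpa only [mem_iUnion₂, mem_iUnion] using hx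
    -- Along the chain the tower stays the same by saturation and disjointness, and the coordinate
    -- moves from `γ` to `g * γ`. The chain thus maps to a `t`-chain in `U j`.
    suffices g • x ∈ P i ∧ dist (g * γ) 1 ≤ D ∧ g * γ ∈ rComponent (U j) t γ by
      rw [← dist_mul_self hinv g γ, dist_comm]
      exact hU.compBdd j γ hγU _ this.2.2
    induction hg with
    | refl => rw [one_smul, one_mul]; exact ⟨hxP, hγD, rComponent_refl _ _ _⟩
    | @tail a b ha hab ih =>
      obtain ⟨haP, haD, haU⟩ := ih
      obtain ⟨-, hb, hd⟩ := hab
      obtain ⟨i', γ', ⟨hγ'D, hγ'U⟩, hbP, hbN⟩ := by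
        simpa only [mem_iUnion₂, mem_iUnion, returnSet, mem_ofPred_eq] using hb
      have hd' : dist (b * a⁻¹) 1 ≤ t := by
        rw [← hinv _ _ a, inv_mul_cancel_right, one_mul, dist_comm]
        exact hd
      have hbP' : b • x ∈ P i := by
        have := hPs i _ haP (b * a⁻¹) (hd'.trans ht)
        rw [smul_smul, inv_mul_cancel_right] at this
        exact this (hPK i' hbP)
      obtain rfl : i = i' := by
        by_contra hne
        exact (hPd i i' hne).le_bot ⟨hbP', hbP⟩
      -- This element returns a base point to the base and has length at most `D + r + D`, so the
      -- new coordinate is forced.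
      have h1 : γ'⁻¹ * ((b * a⁻¹) * (a * γ)) = 1 := by
        refine hN i _ ?_ (γ⁻¹ • x) hxN ?_
        · have h2 := dist_mul_one_le hinv γ'⁻¹ ((b * a⁻¹) * (a * γ))
          have h3 := dist_mul_one_le hinv (b * a⁻¹) (a * γ)
          rw [dist_inv_one hinv] at h2
          linarith
        · rw [smul_smul]
          simpa [mul_assoc, mul_smul] using hbN
      have h2 : γ' = b * γ := by
        rw [inv_mul_eq_one] at h1
        simpa [mul_assoc] using h1
      subst h2
      refine ⟨hbP', hγ'D, rComponent_tail hγU haU hγ'U ?_⟩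
      rw [hinv]
      exact hd

/-- A closed set with bounded `r`-components and covering dimension less than `m` is a union of `m`
sets which inherit closed covers from covers of the group, at all scales up to `r`. -/
theorem exists_pieces_closedCover [CompactSpace X] [T3Space X] [ContinuousConstSMul Γ X]
    (hproper : ∀ (γ : Γ) (r : ℝ), (Metric.closedBall γ r).Finite)
    (hinv : ∀ a b c : Γ, dist (a * c) (b * c) = dist a b)
    (hfree : ∀ (g : Γ) (x : X), g • x = x → g = 1) {K : Set X} (hK : IsClosed K) {r D : ℝ}
    (hr : 0 ≤ r) (hD : 0 ≤ D) (h : OrbitBdd Γ K r D) {m : ℕ} (hm : CovDimLT m K) :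
    ∃ L : Fin m → Set X, K ⊆ ⋃ c, L c ∧ ∀ c (n : ℕ) (t R : ℝ), t ≤ r →
      (∃ U : Fin (n + 1) → Set Γ, IsAsdimCover n t R U) → ClosedCover Γ n (L c) t R := by
  let s := componentSetoid hinv K r
  let π : X → Quotient s := Quotient.mk s
  have hπ : Continuous π := continuous_quotient_mk'
  have hπc : IsClosedMap π := isClosedMap_mk_componentSetoid hproper hK hD h
  have hKc : IsCompact K := hK.isCompact
  choose G hGo hxG hG using fun x : X =>
    exists_open_smul_notMem hfree (finite_dist_one_le hproper (D + r + D)) x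
  -- Equivalent points of `K` differ by an element of length at most `D`, so `π` is injective on
  -- each `K ∩ closure (G x)`; the sum theorem then applies.
  have hQ : CovDimLT m (π '' K) := by
    obtain ⟨t, ht⟩ := hKc.elim_finite_subcover G hGo fun x _ => mem_iUnion.2 ⟨x, hxG x⟩
    have h1 : π '' K = ⋃ x ∈ t, π '' (K ∩ closure (G x)) := by
      refine subset_antisymm ?_ (iUnion₂_subset fun x _ => image_mono inter_subset_left)
      rintro _ ⟨y, hy, rfl⟩
      obtain ⟨x, hx, hyx⟩ := mem_iUnion₂.1 (ht hy)
      exact mem_iUnion₂.2 ⟨x, hx, y, ⟨hy, subset_closure hyx⟩, rfl⟩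
    rw [h1]
    refine CovDimLT.biUnion_finset t fun x _ => ?_
    have hcl : IsClosed (K ∩ closure (G x)) := hK.inter isClosed_closure
    refine (hm.mono hcl inter_subset_left).image hcl hπ hπc fun y hy z hz hyz => ?_
    obtain ⟨-, g, hg, rfl⟩ := exists_of_componentSetoid h hy.1 (Quotient.exact hyz)
    rw [hG x g (by change dist g 1 ≤ _; linarith) y hy.2 hz.2, one_smul]
  let V : X → Set X := fun x => ⋃ g ∈ {g : Γ | dist g 1 ≤ D}, (fun y => g⁻¹ • y) ⁻¹' G x
  have hVo : ∀ x, IsOpen (V x) := fun x => isOpen_biUnion fun g _ =>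
    (hGo x).preimage (continuous_const_smul _)
  -- The classes lying entirely in `V x`: every point of such a class is a short translate of a
  -- point of `G x`.
  let O : X → Set (Quotient s) := fun x => (π '' (V x)ᶜ)ᶜ
  have hOo : ∀ x, IsOpen (O x) := fun x => (hπc _ (hVo x).isClosed_compl).isOpen_compl
  have hxO : ∀ x ∈ K, π x ∈ O x := by
    rintro x hx ⟨y, hy, hxy⟩
    obtain ⟨-, g, hg, rfl⟩ := exists_of_componentSetoid h hx (Quotient.exact hxy.symm)
    exact hy (mem_iUnion₂.2 ⟨g, hg, by simpa using hxG x⟩)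
  obtain ⟨T, hT⟩ := hKc.elim_finite_subcover (fun x => π ⁻¹' O x) (fun x => (hOo x).preimage hπ)
    fun x hx => mem_iUnion.2 ⟨x, hxO x hx⟩
  obtain ⟨P, hPc, hPO, hPd, hPK⟩ := hQ T (fun x => O x) (fun x => hOo x) (by
    rintro _ ⟨y, hy, rfl⟩
    obtain ⟨x, hx, hyx⟩ := mem_iUnion₂.1 (hT hy)
    exact mem_iUnion.2 ⟨⟨x, hx⟩, hyx⟩)
  refine ⟨fun c => ⋃ x : T, K ∩ π ⁻¹' P c x, fun y hy => ?_, fun c n t R ht ⟨U, hU⟩ => ?_⟩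
  · obtain ⟨c, x, hc⟩ := mem_iUnion₂.1 (hPK ⟨y, hy, rfl⟩)
    exact mem_iUnion₂.2 ⟨c, x, hy, hc⟩
  · refine closedCover_iUnion_towers hproper hinv (K := K) (D := D)
      (N := fun x : T => closure (G x))
      (fun x => hK.inter ((hPc c x).preimage hπ)) (fun x => inter_subset_left) ?_ ?_
      (fun x => isClosed_closure) (fun x g hg z hz hgz => hG x g hg z hz hgz) ?_ ht hU
    · rintro x y ⟨hyK, hy⟩ b hb hbK
      have hyb : π y = π (b • y) := Quotient.sound ⟨b, Relation.ReflTransGen.single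
        ⟨one_mem_returnSet hyK, hbK, by rwa [dist_comm]⟩, rfl⟩
      refine ⟨hbK, ?_⟩
      rw [mem_preimage, ← hyb]
      exact hy
    · intro x x' hne
      exact ((hPd c x x' hne).preimage π).mono inter_subset_right inter_subset_right
    · rintro x y ⟨hyK, hy⟩
      have hyV : y ∈ V x := by
        by_contra hyV
        exact hPO c x hy ⟨y, hyV, rfl⟩
      obtain ⟨g, hg, hgy⟩ := mem_iUnion₂.1 hyV
      exact ⟨g, hg, subset_closure hgy⟩

end Components

/-! ### Passing between open covers and closed covers of orbits. -/

namespace TopPartialAction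

variable {Γ : Type u} [Group Γ] [MetricSpace Γ] {X : Type v} [MulAction Γ X] [TopologicalSpace X]
  [ContinuousConstSMul Γ X]

/-- A bound on the number of points reachable from `x` bounds their distance, since the sets reached
within length `k * r` must stop growing. Freeness turns this into a bound on group elements. -/
theorem DadLE.exists_closed_orbitBdd [NormalSpace X]
    (hproper : ∀ (γ : Γ) (r : ℝ), (Metric.closedBall γ r).Finite)
    (hinv : ∀ a b c : Γ, dist (a * c) (b * c) = dist a b)
    (hfree : (ofAction Γ X).IsFree) {d : ℕ} (hd : (ofAction Γ X).DadLE d) {r : ℝ} (hr : 0 ≤ r) :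
    ∃ D, 0 ≤ D ∧ ∃ K : Fin (d + 1) → Set X, (∀ j, IsClosed (K j)) ∧ ⋃ j, K j = univ ∧
      ∀ j, OrbitBdd Γ (K j) r D := by
  obtain ⟨U, hUo, hU, N, hN⟩ := hd (finite_dist_one_le hproper r).toFinset
  obtain ⟨K, hK, hKc, hKU⟩ := exists_iUnion_eq_closed_subset hUo (fun _ => toFinite _) hU
  -- The extra `1` is for the starting point, which `reach` need not contain.
  refine ⟨(N + 1) * r, by positivity, K, hKc, hK, fun j => OrbitBdd.mono ?_ (hKU j)⟩
  intro x hx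
  let S := (ofAction Γ X).Step (finite_dist_one_le (Γ := Γ) hproper r).toFinset (U j)
  have hS : ∀ {y : X} {g : Γ}, dist g 1 ≤ r → g • y ∈ U j → S y (g • y) := fun {y g} hg hy =>
    ⟨g, by simpa using hg, trivial, rfl, hy⟩
  let A : Set X := {y | Relation.ReflTransGen S x y}
  have hA : A.encard ≤ (N + 1 : ℕ) := by
    have : A ⊆ insert x ((ofAction Γ X).reach (finite_dist_one_le (Γ := Γ) hproper r).toFinset
        (U j) x) := by
      intro y hy
      rcases Relation.reflTransGen_iff_eq_or_transGen.1 hy with h | h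
      · exact .inl h
      · exact .inr h
    refine (encard_le_encard this).trans ((encard_insert_le _ _).trans ?_)
    push_cast
    exact add_le_add_left (hN j x hx) 1
  let T : ℕ → Set X := fun k => {y | y ∈ A ∧ ∃ g : Γ, dist g 1 ≤ k * r ∧ g • x = y}
  obtain ⟨k, hkN, hk⟩ := exists_succ_subset_of_encard_le hA (T := T) (by
    rintro a b hab y ⟨hy, g, hg, hgy⟩
    exact ⟨hy, g, hg.trans (by gcongr), hgy⟩) fun k y hy => hy.1
  intro g hg
  suffices g • x ∈ T k by
    obtain ⟨-, g', hg', h⟩ := this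
    rw [← hfree g' g x trivial trivial h]
    refine hg'.trans ?_
    gcongr
    exact_mod_cast hkN
  induction hg with
  | refl => exact ⟨by rw [one_smul]; exact Relation.ReflTransGen.refl, 1, by
      rw [dist_self]; positivity, rfl⟩
  | @tail a b _ hab ih =>
    obtain ⟨hax, a', ha', haa'⟩ := ih
    have hd' : dist (b * a⁻¹) 1 ≤ r := by
      rw [← hinv _ _ a, inv_mul_cancel_right, one_mul, dist_comm]
      exact hab.2.2
    have hb : (b * a⁻¹) • a • x = b • x := by rw [smul_smul, inv_mul_cancel_right]
    refine hk ⟨?_, (b * a⁻¹) * a', ?_, ?_⟩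
    · have := hS (y := a • x) hd' (by rw [hb]; exact hab.2.1)
      rw [hb] at this
      exact Relation.ReflTransGen.tail hax this
    · have := dist_mul_one_le hinv (b * a⁻¹) a'
      push_cast
      linarith
    · rw [mul_smul, haa', hb]

theorem dadLE_restrict_of_closedCover [NormalSpace X]
    (hproper : ∀ (γ : Γ) (r : ℝ), (Metric.closedBall γ r).Finite)
    (hinv : ∀ a b c : Γ, dist (a * c) (b * c) = dist a b) {n : ℕ} {Y : Set X}
    (hY : ∀ r, 0 < r → ∃ R, 0 < R ∧ ClosedCover Γ n Y r R) : (restrict Γ Y).DadLE n := by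
  intro F
  obtain ⟨r, hr, hF⟩ : ∃ r : ℝ, 0 < r ∧ ∀ f ∈ F, dist f 1 ≤ r := by
    obtain ⟨r, hr⟩ := (F.image fun f => dist f 1).bddAbove
    exact ⟨max r 1, by positivity, fun f hf =>
      (hr (Finset.mem_coe.2 (Finset.mem_image_of_mem _ hf))).trans (le_max_left _ _)⟩
  obtain ⟨R, hR, K, hKc, hKY, hK⟩ := hY r hr
  choose G hGo hKG hG using fun j => (hK j).exists_isOpen hproper (hKc j) hr.le hR.le
  refine ⟨fun j => Subtype.val ⁻¹' G j, fun j => (hGo j).preimage continuous_subtype_val, ?_,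
    (finite_dist_one_le (Γ := Γ) hproper R).toFinset.card, fun j x hx => ?_⟩
  · refine eq_univ_of_forall fun y => ?_
    obtain ⟨j, hj⟩ := mem_iUnion.1 (hKY y.2)
    exact mem_iUnion.2 ⟨j, hKG j hj⟩
  · have key : ∀ y ∈ (restrict Γ Y).reach F (Subtype.val ⁻¹' G j) x,
        ∃ g ∈ rComponent (returnSet Γ (G j) (x : X)) r 1, g • (x : X) = y := by
      intro y hy
      have hy' : Relation.ReflTransGen ((restrict Γ Y).Step F (Subtype.val ⁻¹' G j)) x y :=
        Relation.TransGen.to_reflTransGen hy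
      clear hy
      induction hy' with
      | refl => exact ⟨1, rComponent_refl _ _ _, one_smul _ _⟩
      | @tail a b _ hab ih =>
        obtain ⟨g, hg, hga⟩ := ih
        obtain ⟨f, hf, hfa, rfl, hb⟩ := hab
        have hfg : (f * g) • (x : X) = f • (a : X) := by rw [mul_smul, hga]
        refine ⟨f * g, rComponent_tail (one_mem_returnSet hx) hg ?_ ?_, hfg⟩
        · change (f * g) • (x : X) ∈ G j
          rw [hfg]
          exact hb
        · rw [dist_comm, dist_mul_self hinv]
          exact hF f hf
    rw [← Subtype.val_injective.encard_image, ← encard_coe_eq_coe_finsetCard]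
    refine (encard_le_encard (t := (fun g : Γ => g • (x : X)) '' _) ?_).trans (encard_image_le _ _)
    rintro _ ⟨y, hy, rfl⟩
    obtain ⟨g, hg, hgy⟩ := key y hy
    exact ⟨g, by simpa using hG j x hx g hg, hgy⟩

end TopPartialAction

/-! ### Assembling the theorem. -/

theorem exists_le_of_iInf_le_natCast {p : ℕ → Prop} {k : ℕ}
    (h : ⨅ (n : ℕ) (_ : p n), (n : WithBot ℕ∞) ≤ k) : ∃ n, p n := by
  by_contra! hp
  simp only [hp, iInf_false, iInf_top, top_le_iff] at h
  have h' : ((k : ℕ∞) : WithBot ℕ∞) = ((⊤ : ℕ∞) : WithBot ℕ∞) := h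
  exact ENat.natCast_ne_top k (WithBot.coe_injective h')

theorem mainTheorem1 {Γ : Type u} [Group Γ] [Countable Γ] [MetricSpace Γ]
    (hproper : ∀ (γ : Γ) (r : ℝ), (Metric.closedBall γ r).Finite)
    (hinv : ∀ a b c : Γ, dist (a * c) (b * c) = dist a b)
    {X : Type v} [MetricSpace X] [CompactSpace X] [MulAction Γ X] [ContinuousConstSMul Γ X]
    (hfree : (TopPartialAction.ofAction Γ X).IsFree)
    (d : ℕ) (hd : (TopPartialAction.ofAction Γ X).dad ≤ d)
    (Y : Set X) (hY : IsClosed Y) (m : ℕ) (hm : largeInd Y ≤ m) :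
    (TopPartialAction.restrict Γ Y).dad ≤ asdim Γ := by
  by_cases hYe : IsEmpty Y
  · rw [TopPartialAction.dad, if_pos hYe]
    exact bot_le
  have hXe : ¬ IsEmpty X := fun h => hYe inferInstance
  rw [largeInd, if_neg hYe] at hm
  rw [TopPartialAction.dad, if_neg hXe] at hd
  rw [TopPartialAction.dad, asdim, if_neg hYe, if_neg (not_isEmpty_of_nonempty Γ)]
  -- Only finiteness of the two dimensions matters, so any witnesses may replace the given `m` and
  -- `d`.
  obtain ⟨m, hm⟩ := exists_le_of_iInf_le_natCast hm
  obtain ⟨d, hd⟩ := exists_le_of_iInf_le_natCast hd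
  refine le_iInf₂ fun n hn => iInf₂_le_of_le n ?_ le_rfl
  have hdim : CovDimLT (m + 1) Y := by
    have := hY.isClosedEmbedding_subtypeVal.normalSpace
    simpa using (hm.covDimLT _ _).image isClosed_univ continuous_subtype_val
      hY.isClosedEmbedding_subtypeVal.isClosedMap Subtype.val_injective.injOn
  have hfree' : ∀ (g : Γ) (x : X), g • x = x → g = 1 := fun g x h =>
    hfree g 1 x trivial trivial (h.trans (one_smul Γ x).symm)
  choose! ρ hρ hU using hn
  refine TopPartialAction.dadLE_restrict_of_closedCover hproper hinv fun r hr => ?_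
  -- The scale `s` is fixed from the number of pieces before the sets `K` and their bound `D` are
  -- chosen.
  obtain ⟨s, hs, R, hR, hcov⟩ := exists_scale_closedCover_iUnion (X := X) hinv n hρ
    ((d + 1) * (m + 1)) r hr
  obtain ⟨D, hD, K, hKc, hKu, hK⟩ := hd.exists_closed_orbitBdd hproper hinv hfree hs.le
  choose L hKL hL using fun j => exists_pieces_closedCover hproper hinv hfree'
    ((hKc j).inter hY) hs.le hD ((hK j).mono inter_subset_left)
    (hdim.mono ((hKc j).inter hY) inter_subset_right)
  obtain ⟨V, hVc, hV, hVb⟩ := hcov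
    (fun i => L (finProdFinEquiv.symm i).1 (finProdFinEquiv.symm i).2)
    fun i t ht hts => hL _ _ n t _ hts (hU t ht)
  refine ⟨R, hR, V, hVc, fun y hy => hV ?_, hVb⟩
  obtain ⟨j, hj⟩ := mem_iUnion.1 (hKu ▸ mem_univ y : y ∈ ⋃ j, K j)
  obtain ⟨c, hc⟩ := mem_iUnion.1 (hKL j ⟨hj, hy⟩)
  exact mem_iUnion.2 ⟨finProdFinEquiv (j, c), by simpa using hc⟩
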